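/- Let $m,n\ge 1$ and let $\mathbb{P}_m$ be the set of $m\times m$ complex (Hermitian) positive definite matrices, ordered by the Loewner order ($A\ge B$ iff $A-B$ is positive semidefinite). Let $\omega=(w_1,\dots,w_n)$ be a probability vector with all $w_j>0$, and let $\mathbb{A}=(A_1,\dots,A_n)\in\mathbb{P}_m^n$. For real $q$ write $\mathbb{A}^q=(A_1^q,\dots,A_n^q)$. For $0<t\le 1$ the equation \[ X=\sum_{j=1}^n w_j\,(X\#_t A_j),\qquad X\#_t A:=X^{1/2}\bigl(X^{-1/2}AX^{-1/2}\bigr)^tX^{1/2}, \] has a unique solution $X\in\mathbb{P}_m$; it is denoted $P_t(\omega;\mathbb{A})$ (the Lim--Pálfia power mean of order $t$). For $-1\le t<0$ put $P_t(\omega;\mathbb{A}):=P_{-t}(\omega;\mathbb{A}^{-1})^{-1}$. Let $p\ge 1$. Then: (i) if $0<t\le 1$ and $P_t(\omega;\mathbb{A})\ge I$, then $P_t(\omega;\mathbb{A})\le P_t(\omega;\mathbb{A}^p)$; (ii) if $-1\le t<0$ and $P_t(\omega;\mathbb{A})\le I$, then $P_t(\omega;\mathbb{A})\ge P_t(\omega;\mathbb{A}^p)$.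 -/

import Mathlib

open scoped MatrixOrder ComplexOrder

noncomputable section

namespace LimPalfia

/-- The weighted geometric mean `A #ₜ B = A^{1/2} (A^{-1/2} B A^{-1/2})^t A^{1/2}` of positive
definite complex matrices. Real powers of matrices are taken by functional calculus. -/
def geomMean {m : ℕ} (t : ℝ) (A B : Matrix (Fin m) (Fin m) ℂ) : Matrix (Fin m) (Fin m) ℂ :=
  A ^ (1 / 2 : ℝ) * (A ^ (-(1 / 2) : ℝ) * B * A ^ (-(1 / 2) : ℝ)) ^ t * A ^ (1 / 2 : ℝ)

/-- `X` is a positive definite solution of `X = ∑ i, w i • (X #ₜ A i)`. -/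
def IsPowerMeanSolution {m n : ℕ} (t : ℝ) (w : Fin n → ℝ)
    (A : Fin n → Matrix (Fin m) (Fin m) ℂ) (X : Matrix (Fin m) (Fin m) ℂ) : Prop :=
  X.PosDef ∧ X = ∑ i, w i • geomMean t X (A i)

open Classical in
/-- The power mean of order `t ∈ (0, 1]`: the positive definite solution of
`X = ∑ i, w i • (X #ₜ A i)` (and `0` where there is none). -/
def powerMeanPos {m n : ℕ} (t : ℝ) (w : Fin n → ℝ)
    (A : Fin n → Matrix (Fin m) (Fin m) ℂ) : Matrix (Fin m) (Fin m) ℂ :=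
  if h : ∃ X, IsPowerMeanSolution t w A X then h.choose else 0

/-- The Lim–Pálfia power mean of order `t ∈ [-1, 1] \ {0}`: for `t < 0` it is
`P_{-t}(w; A₁⁻¹, …, Aₙ⁻¹)⁻¹`. Values at other `t` have no meaning. -/
def powerMean {m n : ℕ} (t : ℝ) (w : Fin n → ℝ)
    (A : Fin n → Matrix (Fin m) (Fin m) ℂ) : Matrix (Fin m) (Fin m) ℂ :=
  if 0 < t then powerMeanPos t w A
  else (powerMeanPos (-t) w (fun i => (A i)⁻¹))⁻¹

end LimPalfia

end

namespace CStarAlgebra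

section Rpow

variable {R : Type*} [CStarAlgebra R] [PartialOrder R] [StarOrderedRing R]

theorem rpow_unitary_conj {u : R} (hu : u ∈ unitary R) {a : R} (ha : IsStrictlyPositive a)
    (r : ℝ) : (u * a * star u) ^ r = u * a ^ r * star u := by
  have hu' : IsUnit u := ⟨Unitary.toUnits ⟨u, hu⟩, rfl⟩
  have hsp : IsStrictlyPositive (u * a * star u) :=
    hu'.isStrictlyPositive_star_right_conjugate_iff.2 ha
  have key := StarAlgHomClass.map_cfc (S := ℂ) (Unitary.conjStarAlgAut ℂ R ⟨u, hu⟩)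
    (fun x : ℝ => x ^ r) a
    (fun x hx => (Real.continuousAt_rpow_const x r
      (Or.inl (ha.spectrum_pos hx).ne')).continuousWithinAt)
    (by
      have : (Unitary.conjStarAlgAut ℂ R ⟨u, hu⟩ : R → R) = fun x => u * x * star u := by
        ext x; simp
      rw [this]; fun_prop)
    ha.isSelfAdjoint (by simpa using hsp.isSelfAdjoint)
  rw [CFC.rpow_eq_cfc_real (a := a) ha.nonneg, CFC.rpow_eq_cfc_real hsp.nonneg]
  simpa using key.symm

theorem isStrictlyPositive_star_mul_self {s : R} (hs : IsUnit s) :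
    IsStrictlyPositive (star s * s) :=
  (hs.star.mul hs).isStrictlyPositive (star_mul_self_nonneg s)

theorem isStrictlyPositive_mul_star_self {s : R} (hs : IsUnit s) :
    IsStrictlyPositive (s * star s) :=
  (hs.mul hs.star).isStrictlyPositive (mul_star_self_nonneg s)

theorem isStrictlyPositive_rpow {a : R} (ha : IsStrictlyPositive a) (r : ℝ) :
    IsStrictlyPositive (a ^ r) := ha.rpow a r

theorem star_rpow (a : R) (r : ℝ) : star (a ^ r) = a ^ r :=
  (IsSelfAdjoint.of_nonneg CFC.rpow_nonneg).star_eq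

theorem rpow_half_mul_rpow_half {a : R} (ha : IsStrictlyPositive a) :
    a ^ (1 / 2 : ℝ) * a ^ (1 / 2 : ℝ) = a := by
  rw [← CFC.rpow_add ha.isUnit]; norm_num; exact CFC.rpow_one a ha.nonneg

theorem mul_star_mul_self_rpow {s : R} (hs : IsUnit s) (r : ℝ) :
    s * (star s * s) ^ r = (s * star s) ^ r * s := by
  have hP := isStrictlyPositive_mul_star_self hs
  set P := s * star s with hPdef
  obtain ⟨u, hu⟩ : ∃ u, u = P ^ (-(1 / 2) : ℝ) * s := ⟨_, rfl⟩
  have hus : star u = star s * P ^ (-(1 / 2) : ℝ) := by rw [hu, star_mul, star_rpow]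
  have huu : u * star u = 1 := by
    rw [hus, hu, mul_assoc, ← mul_assoc s, ← hPdef, ← mul_assoc]
    exact CFC.conjugate_rpow_neg_one_half P
  have hun : IsUnit u := hu ▸ (isStrictlyPositive_rpow hP _).isUnit.mul hs
  have huu' : star u * u = 1 := by
    have := hun.mul_left_cancel (b := star u * u) (c := 1) (by rw [← mul_assoc, huu]; simp)
    exact this
  have hmem : u ∈ unitary R := Unitary.mem_iff.2 ⟨huu', huu⟩
  have hPu : P ^ (1 / 2 : ℝ) * u = s := by
    rw [hu, ← mul_assoc, CFC.rpow_mul_rpow_neg _ hP, one_mul]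
  have hconj : u * (star s * s) * star u = P := by
    have : u * star s = P ^ (1 / 2 : ℝ) := by
      rw [← hPu, star_mul, star_rpow, ← mul_assoc, huu, one_mul]
    have h2 : s * star u = P ^ (1 / 2 : ℝ) := by
      rw [← hPu, mul_assoc, huu, mul_one]
    rw [← mul_assoc, this, mul_assoc, h2, rpow_half_mul_rpow_half hP]
  have h := rpow_unitary_conj hmem (isStrictlyPositive_star_mul_self hs) r
  rw [hconj] at h
  have h3 : u * (star s * s) ^ r = P ^ r * u := by
    rw [h, mul_assoc, huu', mul_one]
  calc s * (star s * s) ^ r = P ^ (1 / 2 : ℝ) * (u * (star s * s) ^ r) := by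
        rw [← mul_assoc, hPu]
    _ = P ^ r * (P ^ (1 / 2 : ℝ) * u) := by
        rw [h3, ← mul_assoc, ← mul_assoc, ← CFC.rpow_add hP.isUnit, ← CFC.rpow_add hP.isUnit,
          add_comm]
    _ = P ^ r * s := by rw [hPu]

theorem mul_star_self_rpow {s : R} (hs : IsUnit s) (r : ℝ) :
    (s * star s) ^ r = s * (star s * s) ^ (r - 1) * star s := by
  have hP := isStrictlyPositive_mul_star_self hs
  rw [mul_star_mul_self_rpow hs, mul_assoc]
  conv_lhs => rw [show r = (r - 1) + 1 by ring, CFC.rpow_add hP.isUnit,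
    CFC.rpow_one (s * star s) hP.nonneg]

theorem smul_rpow {a : R} (ha : IsStrictlyPositive a) {c : ℝ} (hc : 0 < c) (r : ℝ) :
    (c • a) ^ r = c ^ r • a ^ r := by
  have hca := ha.smul hc
  rw [CFC.rpow_eq_cfc_real hca.nonneg, CFC.rpow_eq_cfc_real ha.nonneg]
  have hcont : ContinuousOn (fun x : ℝ => x ^ r) (spectrum ℝ a) := fun x hx =>
    (Real.continuousAt_rpow_const x r (Or.inl (ha.spectrum_pos hx).ne')).continuousWithinAt
  have hcont' : ContinuousOn (fun x : ℝ => x ^ r) ((c • ·) '' spectrum ℝ a) := by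
    rintro _ ⟨x, hx, rfl⟩
    exact (Real.continuousAt_rpow_const _ r
      (Or.inl (mul_pos hc (ha.spectrum_pos hx)).ne')).continuousWithinAt
  rw [← cfc_smul _ _ _ hcont, ← cfc_comp_smul c _ a hcont' ha.isSelfAdjoint]
  refine cfc_congr fun x hx => ?_
  simp [Real.mul_rpow hc.le (ha.spectrum_pos hx).le]

theorem one_add_smul_sub_one_le_rpow {a : R} (ha : IsStrictlyPositive a) {p : ℝ} (hp : 1 ≤ p) :
    1 + p • (a - 1) ≤ a ^ p := by
  have hsa := ha.isSelfAdjoint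
  have hcont : ContinuousOn (fun x : ℝ => x ^ p) (spectrum ℝ a) := fun x hx =>
    (Real.continuousAt_rpow_const x p (Or.inl (ha.spectrum_pos hx).ne')).continuousWithinAt
  have h1 : cfc (fun x : ℝ => 1 + p • (x - 1)) a = 1 + p • (a - 1) := by
    rw [cfc_add .., cfc_smul .., cfc_sub .., cfc_id' ℝ a, cfc_const_one ℝ a]
  rw [← h1, CFC.rpow_eq_cfc_real ha.nonneg]
  refine cfc_mono (fun x hx => ?_) (by fun_prop) hcont
  have := one_add_mul_self_le_rpow_one_add (s := x - 1)
    (by linarith [ha.spectrum_pos hx]) hp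
  simpa using this

theorem exists_le_smul {x y : R} (hx : IsSelfAdjoint x) (hy : IsStrictlyPositive y) :
    ∃ c : ℝ, 1 ≤ c ∧ x ≤ c • y := by
  set z := y ^ (-(1 / 2) : ℝ) * x * y ^ (-(1 / 2) : ℝ) with hz
  have hzs : IsSelfAdjoint z := by
    rw [IsSelfAdjoint, hz, star_mul, star_mul, star_rpow, hx.star_eq, mul_assoc]
  refine ⟨max 1 ‖z‖, le_max_left _ _, ?_⟩
  have h1 : z ≤ (max 1 ‖z‖) • (1 : R) := by
    refine hzs.le_algebraMap_norm_self.trans ?_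
    rw [Algebra.algebraMap_eq_smul_one]
    exact smul_le_smul_of_nonneg_right (le_max_right _ _) zero_le_one
  have h2 := conjugate_le_conjugate_of_nonneg h1 (CFC.rpow_nonneg (a := y) (y := (1 / 2 : ℝ)))
  have h3 : y ^ (1 / 2 : ℝ) * z * y ^ (1 / 2 : ℝ) = x := by
    calc _ = (y ^ (1 / 2 : ℝ) * y ^ (-(1 / 2) : ℝ)) * x *
          (y ^ (-(1 / 2) : ℝ) * y ^ (1 / 2 : ℝ)) := by rw [hz]; simp only [mul_assoc]
      _ = x := by rw [CFC.rpow_mul_rpow_neg _ hy, CFC.rpow_neg_mul_rpow _ hy]; simp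
  rwa [h3, mul_smul_comm, mul_one, smul_mul_assoc, rpow_half_mul_rpow_half hy] at h2

end Rpow

section Subhomogeneous

open Filter Topology

variable {R : Type*} [CStarAlgebra R] [PartialOrder R] [StarOrderedRing R]
  {f : R → R} {s : ℝ}

omit [PartialOrder R] [StarOrderedRing R] in
theorem tendsto_rpow_pow_smul (hs0 : 0 ≤ s) (hs1 : s < 1) {c : ℝ} (hc : 0 < c) (x : R) :
    Tendsto (fun k : ℕ => c ^ s ^ k • x) atTop (𝓝 x) := by
  have h := (Real.continuousAt_const_rpow (b := 0) hc.ne').tendsto.comp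
    (tendsto_pow_atTop_nhds_zero_of_lt_one hs0 hs1)
  simpa using h.smul_const x

theorem le_of_le_map_of_map_le (hs0 : 0 ≤ s) (hs1 : s < 1)
    (mono : ∀ x y, IsStrictlyPositive x → x ≤ y → f x ≤ f y)
    (hom : ∀ c : ℝ, 0 < c → ∀ x, IsStrictlyPositive x → f (c • x) = c ^ s • f x)
    {x y : R} (hx : IsStrictlyPositive x) (hy : IsStrictlyPositive y)
    (hxf : x ≤ f x) (hyf : f y ≤ y) : x ≤ y := by
  obtain ⟨c, hc, hxy⟩ := exists_le_smul hx.isSelfAdjoint hy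
  have hc0 : 0 < c := by linarith
  refine ge_of_tendsto' (tendsto_rpow_pow_smul hs0 hs1 hc0 y) fun k => ?_
  induction k with
  | zero => simpa using hxy
  | succ k ih =>
    calc x ≤ f x := hxf
      _ ≤ f (c ^ s ^ k • y) := mono _ _ hx ih
      _ = c ^ s ^ (k + 1) • f y := by
        rw [hom _ (by positivity) _ hy, ← Real.rpow_mul hc0.le, pow_succ]
      _ ≤ c ^ s ^ (k + 1) • y := smul_le_smul_of_nonneg_left hyf (by positivity)

theorem exists_fixedPoint_of_le_map_of_map_le (hs0 : 0 ≤ s) (hs1 : s < 1)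
    (pos : ∀ x, IsStrictlyPositive x → IsStrictlyPositive (f x))
    (mono : ∀ x y, IsStrictlyPositive x → x ≤ y → f x ≤ f y)
    (hom : ∀ c : ℝ, 0 < c → ∀ x, IsStrictlyPositive x → f (c • x) = c ^ s • f x)
    {x : R} (hx : IsStrictlyPositive x) {c : ℝ} (hc : 1 ≤ c)
    (hxf : x ≤ f x) (hyf : f (c • x) ≤ c • x) :
    ∃ z, IsStrictlyPositive z ∧ f z = z := by
  have hc0 : 0 < c := by linarith
  have hsp : ∀ k, IsStrictlyPositive (f^[k] x) := fun k => by
    induction k with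
    | zero => exact hx
    | succ k ih => rw [Function.iterate_succ_apply']; exact pos _ ih
  have hmono : Monotone fun k => f^[k] x := monotone_nat_of_le_succ fun k => by
    induction k with
    | zero => exact hxf
    | succ k ih =>
      rw [Function.iterate_succ_apply', Function.iterate_succ_apply' f (k + 1)]
      exact mono _ _ (hsp k) ih
  have hiter : ∀ k, f^[k] (c • x) = c ^ s ^ k • f^[k] x := fun k => by
    induction k with
    | zero => simp
    | succ k ih =>
      rw [Function.iterate_succ_apply', ih, hom _ (by positivity) _ (hsp k),
        Function.iterate_succ_apply', ← Real.rpow_mul hc0.le, pow_succ]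
  have hanti : Antitone fun k => f^[k] (c • x) := antitone_nat_of_succ_le fun k => by
    induction k with
    | zero => exact hyf
    | succ k ih =>
      rw [Function.iterate_succ_apply' f (k + 1)]
      conv_rhs => rw [Function.iterate_succ_apply']
      refine mono _ _ ?_ ih
      rw [hiter]
      exact (hsp _).smul (Real.rpow_pos_of_pos hc0 _)
  have hle : ∀ k l, f^[l] x ≤ c ^ s ^ k • f^[k] x := fun k l => by
    calc f^[l] x ≤ f^[max k l] x := hmono (le_max_right _ _)
      _ ≤ c ^ s ^ (max k l) • f^[max k l] x := by
        conv_lhs => rw [← one_smul ℝ (f^[max k l] x)]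
        exact smul_le_smul_of_nonneg_right (Real.one_le_rpow hc (by positivity)) (hsp _).nonneg
      _ = f^[max k l] (c • x) := (hiter _).symm
      _ ≤ f^[k] (c • x) := hanti (le_max_left _ _)
      _ = _ := hiter k
  have htend : ∀ y : R, Tendsto (fun k : ℕ => c ^ s ^ k • y) atTop (𝓝 y) :=
    tendsto_rpow_pow_smul hs0 hs1 hc0
  have hbound : ∀ k l, k ≤ l →
      dist (f^[k] x) (f^[l] x) ≤ ‖c ^ s ^ k • (c • x) - c • x‖ := fun k l hkl => by
    rw [dist_comm, dist_eq_norm]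
    refine CStarAlgebra.norm_le_norm_of_nonneg_of_le (sub_nonneg.2 (hmono hkl)) ?_
    have h1 : f^[k] x ≤ c • x := by simpa using hle 0 k
    have h2 : 0 ≤ c ^ s ^ k - 1 := sub_nonneg.2 (Real.one_le_rpow hc (by positivity))
    calc f^[l] x - f^[k] x ≤ c ^ s ^ k • f^[k] x - f^[k] x := sub_le_sub_right (hle k l) _
      _ = (c ^ s ^ k - 1) • f^[k] x := by rw [sub_smul, one_smul]
      _ ≤ (c ^ s ^ k - 1) • (c • x) := smul_le_smul_of_nonneg_left h1 h2
      _ = _ := by rw [sub_smul, one_smul]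
  have hcauchy : CauchySeq fun k => f^[k] x := by
    refine cauchySeq_of_le_tendsto_0' _ hbound ?_
    have := ((htend (c • x)).sub_const (c • x)).norm
    simpa using this
  obtain ⟨z, hz⟩ := cauchySeq_tendsto_of_complete hcauchy
  have hkz : ∀ k, f^[k] x ≤ z := fun k => hmono.ge_of_tendsto hz k
  have hzk : ∀ k, z ≤ c ^ s ^ k • f^[k] x := fun k => le_of_tendsto' hz (hle k)
  have hzpos : IsStrictlyPositive z := hx.of_le (hkz 0)
  refine ⟨z, hzpos, le_antisymm ?_ ?_⟩
  · refine ge_of_tendsto' (htend z) fun k => ?_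
    calc f z ≤ f (c ^ s ^ k • f^[k] x) := mono _ _ hzpos (hzk k)
      _ = (c ^ s ^ k) ^ s • f^[k + 1] x := by
        rw [hom _ (by positivity) _ (hsp k), Function.iterate_succ_apply']
      _ ≤ (c ^ s ^ k) ^ s • z := smul_le_smul_of_nonneg_left (hkz _) (by positivity)
      _ ≤ c ^ s ^ k • z := by
        refine smul_le_smul_of_nonneg_right ?_ hzpos.nonneg
        exact Real.rpow_le_self_of_one_le (Real.one_le_rpow hc (by positivity)) hs1.le
  · refine le_of_tendsto' ((tendsto_add_atTop_iff_nat 1).2 hz) fun k => ?_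
    rw [Function.iterate_succ_apply']
    exact mono _ _ (hsp k) (hkz k)

theorem existsUnique_fixedPoint (hs0 : 0 ≤ s) (hs1 : s < 1)
    (pos : ∀ x, IsStrictlyPositive x → IsStrictlyPositive (f x))
    (mono : ∀ x y, IsStrictlyPositive x → x ≤ y → f x ≤ f y)
    (hom : ∀ c : ℝ, 0 < c → ∀ x, IsStrictlyPositive x → f (c • x) = c ^ s • f x) :
    ∃! z, IsStrictlyPositive z ∧ f z = z := by
  have h1 : IsStrictlyPositive (1 : R) := isStrictlyPositive_one
  obtain ⟨a, ha, hla⟩ := exists_le_smul h1.isSelfAdjoint (pos 1 h1)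
  obtain ⟨b, hb, hlb⟩ := exists_le_smul (pos 1 h1).isSelfAdjoint h1
  set d := max a b
  have hd : 1 ≤ d := ha.trans (le_max_left _ _)
  have hd0 : 0 < d := by linarith
  have hda : (1 : R) ≤ d • f 1 :=
    hla.trans (smul_le_smul_of_nonneg_right (le_max_left _ _) (pos 1 h1).nonneg)
  have hdb : f 1 ≤ d • (1 : R) :=
    hlb.trans (smul_le_smul_of_nonneg_right (le_max_right _ _) zero_le_one)
  set e := d ^ (1 - s)⁻¹
  have he0 : 0 < e := by positivity
  have hes : e ^ (1 - s) = d := Real.rpow_inv_rpow hd0.le (by linarith)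
  have hees : d * e ^ s = e := by
    rw [← hes, ← Real.rpow_add he0]; simp
  have he1 : 1 ≤ e := Real.one_le_rpow hd (inv_nonneg.2 (by linarith))
  have hlow : e⁻¹ • (1 : R) ≤ f (e⁻¹ • 1) := by
    rw [hom _ (by positivity) _ h1, Real.inv_rpow he0.le]
    have : (e ^ s)⁻¹ = e⁻¹ * d := by
      rw [inv_eq_iff_eq_inv, mul_inv, inv_inv, ← div_eq_mul_inv, eq_div_iff hd0.ne', mul_comm, hees]
    rw [this, mul_smul]
    exact smul_le_smul_of_nonneg_left hda (by positivity)
  have hupp : f ((e * e) • e⁻¹ • 1) ≤ (e * e) • e⁻¹ • (1 : R) := by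
    rw [smul_smul, mul_assoc, mul_inv_cancel₀ he0.ne', mul_one, hom _ he0 _ h1]
    calc e ^ s • f 1 ≤ e ^ s • d • (1 : R) := smul_le_smul_of_nonneg_left hdb (by positivity)
      _ = e • 1 := by rw [smul_smul, mul_comm, hees]
  obtain ⟨z, hz, hfz⟩ := exists_fixedPoint_of_le_map_of_map_le hs0 hs1 pos mono hom
    (h1.smul (inv_pos.2 he0)) (by nlinarith) hlow hupp
  refine ⟨z, ⟨hz, hfz⟩, fun y ⟨hy, hfy⟩ => le_antisymm ?_ ?_⟩
  · exact le_of_le_map_of_map_le hs0 hs1 mono hom hy hz hfy.ge hfz.le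
  · exact le_of_le_map_of_map_le hs0 hs1 mono hom hz hy hfz.ge hfy.le

end Subhomogeneous

end CStarAlgebra

namespace CStarAlgebra

section GeoMean

variable {R : Type*} [CStarAlgebra R] [PartialOrder R] [StarOrderedRing R]

/-- The weighted geometric mean `a ^ (1/2) * (a ^ (-1/2) * b * a ^ (-1/2)) ^ t * a ^ (1/2)`. -/
noncomputable def geoMean (t : ℝ) (a b : R) : R :=
  a ^ (1 / 2 : ℝ) * (a ^ (-(1 / 2) : ℝ) * b * a ^ (-(1 / 2) : ℝ)) ^ t * a ^ (1 / 2 : ℝ)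

theorem isStrictlyPositive_rpow_mul_mul_rpow {a b : R} (ha : IsStrictlyPositive a)
    (hb : IsStrictlyPositive b) (r : ℝ) : IsStrictlyPositive (a ^ r * b * a ^ r) :=
  .conjugate_of_isUnit_of_isSelfAdjoint b (a ^ r) (isStrictlyPositive_rpow ha r).isUnit
    (isStrictlyPositive_rpow ha r).isSelfAdjoint hb

theorem isStrictlyPositive_geoMean {a b : R} (ha : IsStrictlyPositive a)
    (hb : IsStrictlyPositive b) (t : ℝ) : IsStrictlyPositive (geoMean t a b) :=
  isStrictlyPositive_rpow_mul_mul_rpow ha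
    (isStrictlyPositive_rpow (isStrictlyPositive_rpow_mul_mul_rpow ha hb _) t) _

theorem geoMean_comm {a b : R} (ha : IsStrictlyPositive a) (hb : IsStrictlyPositive b) (t : ℝ) :
    geoMean t a b = geoMean (1 - t) b a := by
  obtain ⟨s, hs⟩ : ∃ s, s = a ^ (-(1 / 2) : ℝ) * b ^ (1 / 2 : ℝ) := ⟨_, rfl⟩
  have hss : star s = b ^ (1 / 2 : ℝ) * a ^ (-(1 / 2) : ℝ) := by
    rw [hs, star_mul, star_rpow, star_rpow]
  have hsu : IsUnit s := hs ▸ (isStrictlyPositive_rpow ha _).isUnit.mul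
    (isStrictlyPositive_rpow hb _).isUnit
  have h1 : a ^ (-(1 / 2) : ℝ) * b * a ^ (-(1 / 2) : ℝ) = s * star s := by
    rw [hss, hs]
    conv_lhs => rw [← rpow_half_mul_rpow_half hb]
    simp only [mul_assoc]
  have hQ := isStrictlyPositive_star_mul_self hsu
  have h2 : b ^ (-(1 / 2) : ℝ) * a * b ^ (-(1 / 2) : ℝ) = (star s * s) ^ (-1 : ℝ) := by
    have hinv : (b ^ (-(1 / 2) : ℝ) * a * b ^ (-(1 / 2) : ℝ)) * (star s * s) = 1 := by
      rw [hss, hs]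
      calc _ = b ^ (-(1 / 2) : ℝ) * a * (b ^ (-(1 / 2) : ℝ) * b ^ (1 / 2 : ℝ)) *
            a ^ (-(1 / 2) : ℝ) * a ^ (-(1 / 2) : ℝ) * b ^ (1 / 2 : ℝ) := by
            simp only [mul_assoc]
        _ = b ^ (-(1 / 2) : ℝ) * (a ^ (1 : ℝ) * a ^ (-(1 / 2) : ℝ) * a ^ (-(1 / 2) : ℝ)) *
            b ^ (1 / 2 : ℝ) := by
            rw [CFC.rpow_neg_mul_rpow _ hb, CFC.rpow_one a ha.nonneg]
            simp only [mul_assoc, one_mul]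
        _ = 1 := by
            rw [← CFC.rpow_add ha.isUnit, ← CFC.rpow_add ha.isUnit]
            norm_num
            rw [CFC.rpow_zero a ha.nonneg, mul_one]
            exact CFC.rpow_neg_mul_rpow _ hb
    have h3 : (star s * s) * (star s * s) ^ (-1 : ℝ) = 1 := by
      conv_lhs => enter [1]; rw [← CFC.rpow_one (star s * s) hQ.nonneg]
      exact CFC.rpow_mul_rpow_neg 1 hQ
    exact left_inv_eq_right_inv hinv h3
  have h4 : b ^ (1 / 2 : ℝ) = a ^ (1 / 2 : ℝ) * s := by
    rw [hs, ← mul_assoc, CFC.rpow_mul_rpow_neg _ ha, one_mul]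
  have h5 : b ^ (1 / 2 : ℝ) = star s * a ^ (1 / 2 : ℝ) := by
    rw [hss, mul_assoc, CFC.rpow_neg_mul_rpow _ ha, mul_one]
  have h6 : geoMean (1 - t) b a =
      a ^ (1 / 2 : ℝ) * s * (star s * s) ^ (t - 1) * (star s * a ^ (1 / 2 : ℝ)) := by
    rw [← h4, ← h5, geoMean, h2, CFC.rpow_rpow _ _ _ (by norm_num) hQ]
    congr 3
    ring
  rw [h6, geoMean, h1, mul_star_self_rpow hsu]
  simp only [mul_assoc]

theorem geoMean_le_geoMean_right (a : R) {b c : R} {t : ℝ} (ht : t ∈ Set.Icc (0 : ℝ) 1)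
    (hbc : b ≤ c) : geoMean t a b ≤ geoMean t a c :=
  conjugate_le_conjugate_of_nonneg (CFC.rpow_le_rpow ht
    (conjugate_le_conjugate_of_nonneg hbc CFC.rpow_nonneg)) CFC.rpow_nonneg

theorem geoMean_le_geoMean_left {a b c : R} {t : ℝ} (ht : t ∈ Set.Icc (0 : ℝ) 1)
    (ha : IsStrictlyPositive a) (hc : IsStrictlyPositive c) (hab : a ≤ b) :
    geoMean t a c ≤ geoMean t b c := by
  rw [geoMean_comm ha hc, geoMean_comm (ha.of_le hab) hc]
  exact geoMean_le_geoMean_right c ⟨by linarith [ht.2], by linarith [ht.1]⟩ hab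

theorem geoMean_smul_left {a b : R} (ha : IsStrictlyPositive a) (hb : IsStrictlyPositive b)
    {c : ℝ} (hc : 0 < c) (t : ℝ) : geoMean t (c • a) b = c ^ (1 - t) • geoMean t a b := by
  rw [geoMean_comm (ha.smul hc) hb, geoMean_comm ha hb, geoMean, geoMean, mul_smul_comm,
    smul_mul_assoc, smul_rpow (isStrictlyPositive_rpow_mul_mul_rpow hb ha _) hc,
    mul_smul_comm, smul_mul_assoc]

theorem conj_rpow_le_rpow_conj {x a : R} (hx : IsStrictlyPositive x) (hx1 : 1 ≤ x)
    (ha : IsStrictlyPositive a) {p : ℝ} (hp : p ∈ Set.Icc (1 : ℝ) 2) :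
    (x ^ (-(1 / 2) : ℝ) * a * x ^ (-(1 / 2) : ℝ)) ^ p ≤
      x ^ (-(1 / 2) : ℝ) * a ^ p * x ^ (-(1 / 2) : ℝ) := by
  have hb := isStrictlyPositive_rpow_mul_mul_rpow hx ha (-(1 / 2))
  obtain ⟨b, hbdef⟩ : ∃ b, b = x ^ (-(1 / 2) : ℝ) * a * x ^ (-(1 / 2) : ℝ) := ⟨_, rfl⟩
  rw [← hbdef] at hb ⊢
  obtain ⟨s, hs⟩ : ∃ s, s = x ^ (1 / 2 : ℝ) * b ^ (1 / 2 : ℝ) := ⟨_, rfl⟩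
  have hss : star s = b ^ (1 / 2 : ℝ) * x ^ (1 / 2 : ℝ) := by
    rw [hs, star_mul, star_rpow, star_rpow]
  have hsu : IsUnit s := hs ▸ (isStrictlyPositive_rpow hx _).isUnit.mul
    (isStrictlyPositive_rpow hb _).isUnit
  have h1 : s * star s = a := by
    calc _ = x ^ (1 / 2 : ℝ) * (b ^ (1 / 2 : ℝ) * b ^ (1 / 2 : ℝ)) * x ^ (1 / 2 : ℝ) := by
          rw [hss, hs]; simp only [mul_assoc]
      _ = (x ^ (1 / 2 : ℝ) * x ^ (-(1 / 2) : ℝ)) * a *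
          (x ^ (-(1 / 2) : ℝ) * x ^ (1 / 2 : ℝ)) := by
          rw [rpow_half_mul_rpow_half hb, hbdef]; simp only [mul_assoc]
      _ = a := by rw [CFC.rpow_mul_rpow_neg _ hx, CFC.rpow_neg_mul_rpow _ hx]; simp
  have h2 : b ≤ star s * s := by
    calc b = b ^ (1 / 2 : ℝ) * 1 * b ^ (1 / 2 : ℝ) := by rw [mul_one, rpow_half_mul_rpow_half hb]
      _ ≤ b ^ (1 / 2 : ℝ) * x * b ^ (1 / 2 : ℝ) :=
        conjugate_le_conjugate_of_nonneg hx1 CFC.rpow_nonneg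
      _ = star s * s := by
        rw [hss, hs]
        conv_lhs => rw [← rpow_half_mul_rpow_half hx]
        simp only [mul_assoc]
  have h3 : x ^ (-(1 / 2) : ℝ) * s = b ^ (1 / 2 : ℝ) := by
    rw [hs, ← mul_assoc, CFC.rpow_neg_mul_rpow _ hx, one_mul]
  have h4 : star s * x ^ (-(1 / 2) : ℝ) = b ^ (1 / 2 : ℝ) := by
    rw [hss, mul_assoc, CFC.rpow_mul_rpow_neg _ hx, mul_one]
  calc b ^ p = b ^ (1 / 2 : ℝ) * b ^ (p - 1) * b ^ (1 / 2 : ℝ) := by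
        rw [← CFC.rpow_add hb.isUnit, ← CFC.rpow_add hb.isUnit]
        congr 1
        ring
    _ ≤ b ^ (1 / 2 : ℝ) * (star s * s) ^ (p - 1) * b ^ (1 / 2 : ℝ) :=
        conjugate_le_conjugate_of_nonneg
          (CFC.rpow_le_rpow ⟨by linarith [hp.1], by linarith [hp.2]⟩ h2) CFC.rpow_nonneg
    _ = (x ^ (-(1 / 2) : ℝ) * s) * (star s * s) ^ (p - 1) *
          (star s * x ^ (-(1 / 2) : ℝ)) := by rw [h3, h4]
    _ = x ^ (-(1 / 2) : ℝ) * (s * star s) ^ p * x ^ (-(1 / 2) : ℝ) := by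
        rw [mul_star_self_rpow hsu p]; simp only [mul_assoc]
    _ = _ := by rw [h1]

theorem add_smul_geoMean_sub_le {x a : R} (hx : IsStrictlyPositive x) (hx1 : 1 ≤ x)
    (ha : IsStrictlyPositive a) {p : ℝ} (hp : p ∈ Set.Icc (1 : ℝ) 2) {t : ℝ} (ht0 : 0 < t)
    (ht1 : t ≤ 1) : x + p • (geoMean t x a - x) ≤ geoMean t x (a ^ p) := by
  have hb := isStrictlyPositive_rpow_mul_mul_rpow hx ha (-(1 / 2))
  have h := CFC.rpow_le_rpow ⟨ht0.le, ht1⟩ (conj_rpow_le_rpow_conj hx hx1 ha hp)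
  rw [CFC.rpow_rpow _ _ _ (by linarith [hp.1]) hb, mul_comm p t,
    ← CFC.rpow_rpow _ _ _ ht0.ne' hb] at h
  have h1 := conjugate_le_conjugate_of_nonneg
    ((one_add_smul_sub_one_le_rpow (isStrictlyPositive_rpow hb t) hp.1).trans h)
    (CFC.rpow_nonneg (a := x) (y := (1 / 2 : ℝ)))
  refine le_of_eq_of_le ?_ h1
  rw [geoMean, mul_add, add_mul, mul_one, rpow_half_mul_rpow_half hx, mul_smul_comm,
    smul_mul_assoc, mul_sub, sub_mul, mul_one, rpow_half_mul_rpow_half hx]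

end GeoMean

section PowerMean

variable {R : Type*} [CStarAlgebra R] [PartialOrder R] [StarOrderedRing R]
  {ι : Type*} [Fintype ι] {w : ι → ℝ} {A : ι → R} {t : ℝ}

theorem isStrictlyPositive_sum_smul [Nonempty ι] (hw : ∀ i, 0 < w i)
    (hA : ∀ i, IsStrictlyPositive (A i)) : IsStrictlyPositive (∑ i, w i • A i) := by
  obtain ⟨i⟩ := ‹Nonempty ι›
  refine ((hA i).smul (hw i)).of_le ?_
  exact Finset.single_le_sum (f := fun i => w i • A i)
    (fun j _ => ((hA j).smul (hw j)).nonneg) (Finset.mem_univ i)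

theorem sum_smul_geoMean_mono (hw : ∀ i, 0 < w i) (hA : ∀ i, IsStrictlyPositive (A i))
    (ht0 : 0 < t) (ht1 : t ≤ 1) (x y : R) (hx : IsStrictlyPositive x) (hxy : x ≤ y) :
    ∑ i, w i • geoMean t x (A i) ≤ ∑ i, w i • geoMean t y (A i) :=
  Finset.sum_le_sum fun i _ => smul_le_smul_of_nonneg_left
    (geoMean_le_geoMean_left ⟨ht0.le, ht1⟩ hx (hA i) hxy) (hw i).le

theorem sum_smul_geoMean_smul (hA : ∀ i, IsStrictlyPositive (A i)) (c : ℝ) (hc : 0 < c) (x : R)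
    (hx : IsStrictlyPositive x) :
    ∑ i, w i • geoMean t (c • x) (A i) = c ^ (1 - t) • ∑ i, w i • geoMean t x (A i) := by
  rw [Finset.smul_sum]
  exact Finset.sum_congr rfl fun i _ => by rw [geoMean_smul_left hx (hA i) hc, smul_comm]

theorem existsUnique_powerMean [Nonempty ι] (hw : ∀ i, 0 < w i)
    (hA : ∀ i, IsStrictlyPositive (A i)) (ht0 : 0 < t) (ht1 : t ≤ 1) :
    ∃! x, IsStrictlyPositive x ∧ ∑ i, w i • geoMean t x (A i) = x :=
  existsUnique_fixedPoint (s := 1 - t) (by linarith) (by linarith)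
    (fun _ hx => isStrictlyPositive_sum_smul hw fun i => isStrictlyPositive_geoMean hx (hA i) t)
    (sum_smul_geoMean_mono hw hA ht0 ht1) (sum_smul_geoMean_smul hA)

theorem powerMean_le_powerMean_rpow_of_le_two (hw : ∀ i, 0 < w i) (hw1 : ∑ i, w i = 1)
    (hA : ∀ i, IsStrictlyPositive (A i)) (ht0 : 0 < t) (ht1 : t ≤ 1) {p : ℝ}
    (hp : p ∈ Set.Icc (1 : ℝ) 2) {x y : R} (hx : IsStrictlyPositive x)
    (hxA : ∑ i, w i • geoMean t x (A i) = x) (hx1 : 1 ≤ x) (hy : IsStrictlyPositive y)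
    (hyA : ∑ i, w i • geoMean t y (A i ^ p) = y) : x ≤ y := by
  have hAp : ∀ i, IsStrictlyPositive (A i ^ p) := fun i => isStrictlyPositive_rpow (hA i) p
  refine le_of_le_map_of_map_le (s := 1 - t) (by linarith) (by linarith)
    (sum_smul_geoMean_mono hw hAp ht0 ht1) (sum_smul_geoMean_smul hAp) hx hy ?_ hyA.le
  calc x = ∑ i, w i • (x + p • (geoMean t x (A i) - x)) := by
        simp only [smul_add, smul_comm _ p, smul_sub, Finset.sum_add_distrib,
          Finset.sum_sub_distrib, ← Finset.smul_sum, hxA, ← Finset.sum_smul, hw1, one_smul,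
          sub_self, add_zero]
    _ ≤ ∑ i, w i • geoMean t x (A i ^ p) := Finset.sum_le_sum fun i _ =>
        smul_le_smul_of_nonneg_left (add_smul_geoMean_sub_le hx hx1 (hA i) hp ht0 ht1) (hw i).le

theorem powerMean_le_powerMean_rpow [Nonempty ι] (hw : ∀ i, 0 < w i) (hw1 : ∑ i, w i = 1)
    (hA : ∀ i, IsStrictlyPositive (A i)) (ht0 : 0 < t) (ht1 : t ≤ 1) {p : ℝ} (hp : 1 ≤ p)
    {x y : R} (hx : IsStrictlyPositive x) (hxA : ∑ i, w i • geoMean t x (A i) = x)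
    (hx1 : 1 ≤ x) (hy : IsStrictlyPositive y)
    (hyA : ∑ i, w i • geoMean t y (A i ^ p) = y) : x ≤ y := by
  obtain ⟨k, hk⟩ := pow_unbounded_of_one_lt p (one_lt_two (α := ℝ))
  induction k generalizing p y with
  | zero => exact absurd hk (by simpa using hp)
  | succ k ih =>
    obtain hp2 | hp2 := le_total p 2
    · exact powerMean_le_powerMean_rpow_of_le_two hw hw1 hA ht0 ht1 ⟨hp, hp2⟩ hx hxA hx1 hy hyA
    · have hAp : ∀ i, IsStrictlyPositive (A i ^ (p / 2)) :=
        fun i => isStrictlyPositive_rpow (hA i) _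
      obtain ⟨z, ⟨hz, hzA⟩, -⟩ := existsUnique_powerMean hw hAp ht0 ht1
      have hxz : x ≤ z := ih (by linarith) hz hzA (by rw [pow_succ] at hk; linarith)
      refine hxz.trans (powerMean_le_powerMean_rpow_of_le_two hw hw1 hAp ht0 ht1 (p := 2)
        ⟨one_le_two, le_rfl⟩ hz hzA (hx1.trans hxz) hy ?_)
      have : ∀ i, (A i ^ (p / 2)) ^ (2 : ℝ) = A i ^ p := fun i => by
        rw [CFC.rpow_rpow _ _ _ (by linarith) (hA i), div_mul_cancel₀ _ two_ne_zero]
      simpa only [this] using hyA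

end PowerMean

end CStarAlgebra

namespace LimPalfia

section Matrix

open scoped Matrix.Norms.L2Operator

variable {m n : ℕ} {t : ℝ} {w : Fin n → ℝ} {A : Fin n → Matrix (Fin m) (Fin m) ℂ}

theorem isPowerMeanSolution_iff {X : Matrix (Fin m) (Fin m) ℂ} :
    IsPowerMeanSolution t w A X ↔
      IsStrictlyPositive X ∧ ∑ i, w i • CStarAlgebra.geoMean t X (A i) = X := by
  rw [Matrix.isStrictlyPositive_iff_posDef, eq_comm (b := X)]
  rfl

theorem nonempty_of_sum_eq_one {ι : Type*} [Fintype ι] {w : ι → ℝ} (hw1 : ∑ i, w i = 1) :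
    Nonempty ι := by
  by_contra h
  rw [not_nonempty_iff] at h
  simp at hw1

theorem existsUnique_isPowerMeanSolution (hw : ∀ i, 0 < w i) (hw1 : ∑ i, w i = 1)
    (hA : ∀ i, (A i).PosDef) (ht0 : 0 < t) (ht1 : t ≤ 1) :
    ∃! X, IsPowerMeanSolution t w A X := by
  have := nonempty_of_sum_eq_one hw1
  simp only [isPowerMeanSolution_iff]
  exact CStarAlgebra.existsUnique_powerMean hw (fun i => (hA i).isStrictlyPositive) ht0 ht1

theorem isPowerMeanSolution_powerMeanPos (hw : ∀ i, 0 < w i) (hw1 : ∑ i, w i = 1)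
    (hA : ∀ i, (A i).PosDef) (ht0 : 0 < t) (ht1 : t ≤ 1) :
    IsPowerMeanSolution t w A (powerMeanPos t w A) := by
  have h := (existsUnique_isPowerMeanSolution hw hw1 hA ht0 ht1).exists
  rw [powerMeanPos, dif_pos h]
  exact h.choose_spec

theorem posDef_rpow {B : Matrix (Fin m) (Fin m) ℂ} (hB : B.PosDef) (p : ℝ) : (B ^ p).PosDef :=
  Matrix.isStrictlyPositive_iff_posDef.1
    (CStarAlgebra.isStrictlyPositive_rpow hB.isStrictlyPositive p)

theorem powerMeanPos_le_powerMeanPos_rpow (hw : ∀ i, 0 < w i) (hw1 : ∑ i, w i = 1)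
    (hA : ∀ i, (A i).PosDef) (ht0 : 0 < t) (ht1 : t ≤ 1) {p : ℝ} (hp : 1 ≤ p)
    (h : 1 ≤ powerMeanPos t w A) :
    powerMeanPos t w A ≤ powerMeanPos t w (fun i => A i ^ p) := by
  have := nonempty_of_sum_eq_one hw1
  obtain ⟨hX, hXA⟩ := isPowerMeanSolution_iff.1
    (isPowerMeanSolution_powerMeanPos hw hw1 hA ht0 ht1)
  obtain ⟨hY, hYA⟩ := isPowerMeanSolution_iff.1
    (isPowerMeanSolution_powerMeanPos hw hw1 (fun i => posDef_rpow (hA i) p) ht0 ht1)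
  exact CStarAlgebra.powerMean_le_powerMean_rpow hw hw1 (fun i => (hA i).isStrictlyPositive)
    ht0 ht1 hp hX hXA h hY hYA

theorem inv_le_inv_of_posDef {B C : Matrix (Fin m) (Fin m) ℂ} (hB : B.PosDef) (h : B ≤ C) :
    C⁻¹ ≤ B⁻¹ := by
  rw [Matrix.nonsing_inv_eq_ringInverse, Matrix.nonsing_inv_eq_ringInverse]
  exact CStarAlgebra.ringInverse_le_ringInverse h hB.isStrictlyPositive

theorem inv_rpow {B : Matrix (Fin m) (Fin m) ℂ} (hB : B.PosDef) {p : ℝ} (hp : p ≠ 0) :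
    (B ^ p)⁻¹ = B⁻¹ ^ p := by
  have hB' := hB.isStrictlyPositive
  rw [Matrix.nonsing_inv_eq_ringInverse, Matrix.nonsing_inv_eq_ringInverse,
    CFC.inverse_rpow B p hp hB', CFC.inverse_eq_rpow_neg_one hB',
    CFC.rpow_rpow B _ _ (by norm_num) hB', neg_one_mul]

end Matrix

end LimPalfia

/-- The first conjunct says that the power means are well defined; the other two are the
Ando–Hiai type inequalities, in the Loewner order. -/
theorem theoremT {m n : ℕ} (w : Fin n → ℝ) (hw : ∀ i, 0 < w i) (hw1 : ∑ i, w i = 1)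
    (A : Fin n → Matrix (Fin m) (Fin m) ℂ) (hA : ∀ i, (A i).PosDef)
    (p : ℝ) (hp : 1 ≤ p) :
    (∀ t : ℝ, 0 < t → t ≤ 1 →
      ∃! X : Matrix (Fin m) (Fin m) ℂ, LimPalfia.IsPowerMeanSolution t w A X) ∧
    (∀ t : ℝ, 0 < t → t ≤ 1 →
      1 ≤ LimPalfia.powerMean t w A →
      LimPalfia.powerMean t w A ≤ LimPalfia.powerMean t w (fun i => (A i) ^ p)) ∧
    (∀ t : ℝ, -1 ≤ t → t < 0 →
      LimPalfia.powerMean t w A ≤ 1 →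
      LimPalfia.powerMean t w (fun i => (A i) ^ p) ≤ LimPalfia.powerMean t w A) := by

  refine ⟨fun t ht0 ht1 => LimPalfia.existsUnique_isPowerMeanSolution hw hw1 hA ht0 ht1,
    fun t ht0 ht1 h => ?_, fun t ht1 ht0 h => ?_⟩
  · simp only [LimPalfia.powerMean, if_pos ht0] at h ⊢
    exact LimPalfia.powerMeanPos_le_powerMeanPos_rpow hw hw1 hA ht0 ht1 hp h
  · simp only [LimPalfia.powerMean, if_neg ht0.not_gt] at h ⊢
    have hA' : ∀ i, ((A i)⁻¹).PosDef := fun i => (hA i).inv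
    have hs0 : 0 < -t := by linarith
    have hs1 : -t ≤ 1 := by linarith
    have hX := (LimPalfia.isPowerMeanSolution_powerMeanPos hw hw1 hA' hs0 hs1).1
    have h1 : 1 ≤ LimPalfia.powerMeanPos (-t) w (fun i => (A i)⁻¹) := by
      have := LimPalfia.inv_le_inv_of_posDef hX.inv h
      rwa [inv_one, Matrix.nonsing_inv_nonsing_inv _ ((Matrix.isUnit_iff_isUnit_det _).1
        hX.isUnit)] at this
    have h2 := LimPalfia.powerMeanPos_le_powerMeanPos_rpow hw hw1 hA' hs0 hs1 hp h1
    simp only [LimPalfia.inv_rpow (hA _) (by linarith : p ≠ 0)]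
    exact LimPalfia.inv_le_inv_of_posDef hX h2
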